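/- Corollary 2.6 (Wiener chaos estimate). There is an absolute constant $C>0$ with the following property. Let $S$ be a finite set, let $(g_s)_{s\in S}$ be independent real Gaussian random variables of mean zero and variance one, let $k\ge 0$ be an integer, let $H$ be a finite-dimensional complex Hilbert space, and for each subset $A\subseteq S$ with $|A|\le k$ let $c_A\in H$. Then for every real $2\le p<\infty$ the random variable $\bigl\|\sum_{A\subseteq S,\,|A|\le k} c_A\prod_{s\in A} g_s\bigr\|_H^p$ is integrable and $$\mathbb{E}\Bigl\|\sum_{A\subseteq S,\ |A|\le k} c_A\prod_{s\in A} g_s\Bigr\|_H^p \le (Cp)^{kp/2}\Bigl(\sum_{A\subseteq S,\ |A|\le k}\|c_A\|_H^2\Bigr)^{p/2}.$$ -/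

import Mathlib

open MeasureTheory ProbabilityTheory

/-
Only one-variable information is needed. For a standard Gaussian `t`, comparing binomial
coefficients term by term gives Nelson's inequality `E (x + t y) ^ (2n) ≤ (x² + (2n - 1) y²) ^ n`.
It passes to vectors `x`, `y` of a Hilbert space: after symmetrising in `t`, the odd powers of
`⟪x, y⟫` cancel, and the even ones are largest when `x` and `y` are parallel.

A multilinear polynomial is affine in each variable. Integrating out one variable replaces its
coefficients `c A`, `c (insert i A)` by the single coefficient `(c A, √(2n - 1) c (insert i A))` in
the `L²` sum `H ⊕ H`, so induction over the variables applies once the Hilbert space is allowed to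
change. In degree at most `k` this costs a factor `(2n - 1) ^ k` in the sum of squares, and
Lyapunov's inequality interpolates from `2n` down to an arbitrary exponent `p ≤ 2n`.
-/

open scoped NNReal ENNReal Nat

theorem integral_odd_pow_eq_zero {μ : Measure ℝ} [μ.IsNegInvariant] {i : ℕ} (hi : Odd i) :
    ∫ x, x ^ i ∂μ = 0 := by
  have h := integral_neg_eq_self (fun x : ℝ ↦ x ^ i) μ
  simp only [hi.neg_pow, integral_neg] at h
  linarith

theorem two_mul_lintegral_eq_lintegral_add_comp_neg {G : Type*} [MeasurableSpace G]
    [InvolutiveNeg G] [MeasurableNeg G] {μ : Measure G} [μ.IsNegInvariant] {f : G → ℝ≥0∞}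
    (hf : Measurable f) : 2 * ∫⁻ x, f x ∂μ = ∫⁻ x, f x + f (-x) ∂μ := by
  rw [lintegral_add_left hf, lintegral_neg_eq_self f, two_mul]

instance isNegInvariant_gaussianReal (v : ℝ≥0) : (gaussianReal 0 v).IsNegInvariant where
  neg_eq_self := by
    rw [Measure.neg]
    exact gaussianReal_map_neg.trans (by rw [neg_zero])

theorem hasDerivAt_gaussianPDFReal (μ : ℝ) (v : ℝ≥0) (x : ℝ) :
    HasDerivAt (gaussianPDFReal μ v) (-((x - μ) / v) * gaussianPDFReal μ v x) x := by
  have h := ((((hasDerivAt_id' x).sub_const μ).fun_pow 2).fun_neg.div_const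
    (2 * (v : ℝ))).exp.const_mul (√(2 * Real.pi * v))⁻¹
  refine h.congr_deriv ?_
  rw [gaussianPDFReal]
  push_cast
  ring

theorem integrable_pow_gaussianReal (μ : ℝ) (v : ℝ≥0) (n : ℕ) :
    Integrable (fun x : ℝ ↦ x ^ n) (gaussianReal μ v) := by
  refine (integrable_norm_iff (by fun_prop)).1 ?_
  simpa only [norm_pow, id_eq] using
    (memLp_id_gaussianReal (μ := μ) (v := v) (n : ℝ≥0)).integrable_norm_pow'

theorem integrable_gaussianPDFReal_mul_pow (μ : ℝ) {v : ℝ≥0} (hv : v ≠ 0) (n : ℕ) :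
    Integrable (fun x ↦ gaussianPDFReal μ v x * x ^ n) := by
  have h := integrable_pow_gaussianReal μ v n
  rw [gaussianReal_of_var_ne_zero μ hv, integrable_withDensity_iff_integrable_smul'
    (measurable_gaussianPDF μ v) (ae_of_all _ fun _ ↦ gaussianPDF_lt_top)] at h
  simpa only [toReal_gaussianPDF, smul_eq_mul] using h

theorem integral_pow_add_two_gaussianReal (v : ℝ≥0) (n : ℕ) :
    ∫ x, x ^ (n + 2) ∂(gaussianReal 0 v) = (n + 1) * v * ∫ x, x ^ n ∂(gaussianReal 0 v) := by
  rcases eq_or_ne v 0 with rfl | hv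
  · simp
  have hv' : (v : ℝ) ≠ 0 := by exact_mod_cast hv
  have hint := integrable_gaussianPDFReal_mul_pow 0 hv
  have hderiv (x : ℝ) : HasDerivAt (fun x ↦ v * (gaussianPDFReal 0 v x * x ^ (n + 1)))
      ((n + 1) * v * (gaussianPDFReal 0 v x * x ^ n) - gaussianPDFReal 0 v x * x ^ (n + 2)) x := by
    refine (((hasDerivAt_gaussianPDFReal 0 v x).mul (hasDerivAt_pow (n + 1) x)).const_mul
      (v : ℝ)).congr_deriv ?_
    rw [Nat.add_sub_cancel]
    push_cast
    field_simp
    ring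
  have hzero := integral_eq_zero_of_hasDerivAt_of_integrable hderiv
    (((hint n).const_mul _).sub (hint (n + 2))) ((hint (n + 1)).const_mul _)
  rw [integral_sub ((hint n).const_mul _) (hint (n + 2)), integral_const_mul] at hzero
  simp only [integral_gaussianReal_eq_integral_smul hv, smul_eq_mul]
  linarith

theorem integral_even_pow_gaussianReal (v : ℝ≥0) (j : ℕ) :
    ∫ x, x ^ (2 * j) ∂(gaussianReal 0 v) = v ^ j * (2 * j - 1)‼ := by
  induction j with
  | zero => simp
  | succ j ih =>
    have hfact : (2 * (j + 1) - 1)‼ = (2 * j + 1) * (2 * j - 1)‼ := Nat.doubleFactorial_add_one _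
    rw [mul_add_one, integral_pow_add_two_gaussianReal, ih, ← mul_add_one, hfact]
    push_cast
    ring

theorem choose_mul_doubleFactorial_le (n j : ℕ) :
    (2 * n).choose (2 * j) * (2 * j - 1)‼ ≤ n.choose j * (2 * n - 1) ^ j := by
  induction j with
  | zero => simp
  | succ j ih =>
    have hfact : (2 * (j + 1) - 1)‼ = (2 * j + 1) * (2 * j - 1)‼ := Nat.doubleFactorial_add_one _
    have hodd := Nat.choose_succ_right_eq (2 * n) (2 * j)
    have heven := Nat.choose_succ_right_eq (2 * n) (2 * j + 1)
    have hn := Nat.choose_succ_right_eq n j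
    have hsub : 2 * n - 2 * j = 2 * (n - j) := by omega
    refine le_of_mul_le_mul_left ?_ (show 0 < 2 * (j + 1) by positivity)
    calc 2 * (j + 1) * ((2 * n).choose (2 * (j + 1)) * (2 * (j + 1) - 1)‼)
        = (2 * n).choose (2 * j + 1 + 1) * (2 * j + 1 + 1) * (2 * j + 1) * (2 * j - 1)‼ := by
          rw [hfact, show 2 * (j + 1) = 2 * j + 1 + 1 from rfl]; ring
      _ = (2 * n).choose (2 * j + 1) * (2 * j + 1) * (2 * n - (2 * j + 1)) * (2 * j - 1)‼ := by
          rw [heven]; ring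
      _ = 2 * (n - j) * (2 * n - (2 * j + 1)) * ((2 * n).choose (2 * j) * (2 * j - 1)‼) := by
          rw [hodd, hsub]; ring
      _ ≤ 2 * (n - j) * (2 * n - 1) * (n.choose j * (2 * n - 1) ^ j) := by
          gcongr
          omega
      _ = 2 * (n.choose j * (n - j)) * (2 * n - 1) ^ (j + 1) := by ring
      _ = 2 * (j + 1) * (n.choose (j + 1) * (2 * n - 1) ^ (j + 1)) := by rw [← hn]; ring

theorem integrable_add_mul_pow_gaussianReal (v : ℝ≥0) (x y : ℝ) (n : ℕ) :
    Integrable (fun t ↦ (x + t * y) ^ n) (gaussianReal 0 v) := by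
  simp only [add_pow, mul_pow]
  exact integrable_finsetSum _ fun i _ ↦
    ((((integrable_pow_gaussianReal 0 v _).mul_const _).const_mul _).mul_const _)

theorem sum_range_two_mul_add_one_eq_sum_even {M : Type*} [AddCommMonoid M] {f : ℕ → M}
    (hf : ∀ i, Odd i → f i = 0) (n : ℕ) :
    ∑ i ∈ Finset.range (2 * n + 1), f i = ∑ j ∈ Finset.range (n + 1), f (2 * j) := by
  refine (Finset.sum_of_injOn (2 * ·) (mul_right_injective₀ two_ne_zero).injOn
    (fun j hj ↦ ?_) (fun i hi himage ↦ hf i ?_) fun _ _ ↦ rfl).symm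
  · simp only [Finset.coe_range, Set.mem_Iio] at hj ⊢
    omega
  · by_contra hodd
    obtain ⟨j, rfl⟩ := even_iff_exists_two_mul.1 (Nat.not_odd_iff_even.1 hodd)
    exact himage ⟨j, by simpa using hi, rfl⟩

theorem integral_add_mul_even_pow_gaussianReal (v : ℝ≥0) (x y : ℝ) (n : ℕ) :
    ∫ t, (x + t * y) ^ (2 * n) ∂(gaussianReal 0 v) = ∑ j ∈ Finset.range (n + 1),
      ((2 * n).choose (2 * j) * (2 * j - 1)‼ : ℕ) * ((v * y ^ 2) ^ j * (x ^ 2) ^ (n - j)) := by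
  have hexpand (t : ℝ) : (x + t * y) ^ (2 * n) = ∑ i ∈ Finset.range (2 * n + 1),
      (2 * n).choose i * y ^ i * x ^ (2 * n - i) * t ^ i := by
    rw [add_comm, add_pow]
    exact Finset.sum_congr rfl fun i _ ↦ by ring
  simp only [hexpand]
  rw [integral_finsetSum _ fun i _ ↦ (integrable_pow_gaussianReal 0 v i).const_mul _]
  simp only [integral_const_mul]
  rw [sum_range_two_mul_add_one_eq_sum_even fun i hi ↦ by
    rw [integral_odd_pow_eq_zero hi, mul_zero]]
  refine Finset.sum_congr rfl fun j _ ↦ ?_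
  rw [integral_even_pow_gaussianReal, ← Nat.mul_sub, pow_mul, pow_mul]
  push_cast
  ring

/-- `(2, 2n)`-hypercontractivity of a law `μ` on `ℝ`, tested on affine functions, with `K` the
square of the hypercontractivity constant; the condition to be checked in each coordinate of a
product measure. Since the moment is a lower Lebesgue integral, its finiteness is included. -/
def IsHypercontractive (μ : Measure ℝ) (n : ℕ) (K : ℝ≥0) : Prop :=
  ∀ x y : ℝ, ∫⁻ t, ENNReal.ofReal ((x + t * y) ^ (2 * n)) ∂μ
    ≤ ENNReal.ofReal ((x ^ 2 + K * y ^ 2) ^ n)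

theorem isHypercontractive_gaussianReal (v : ℝ≥0) (n : ℕ) :
    IsHypercontractive (gaussianReal 0 v) n ((2 * n - 1 : ℕ) * v) := by
  intro x y
  rw [← ofReal_integral_eq_lintegral_ofReal (integrable_add_mul_pow_gaussianReal v x y _)
    (ae_of_all _ fun _ ↦ (even_two_mul n).pow_nonneg _), integral_add_mul_even_pow_gaussianReal]
  refine ENNReal.ofReal_le_ofReal ?_
  calc ∑ j ∈ Finset.range (n + 1),
        ((2 * n).choose (2 * j) * (2 * j - 1)‼ : ℕ) * ((v * y ^ 2) ^ j * (x ^ 2) ^ (n - j))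
      ≤ ∑ j ∈ Finset.range (n + 1),
        (n.choose j * (2 * n - 1) ^ j : ℕ) * ((v * y ^ 2) ^ j * (x ^ 2) ^ (n - j)) :=
        Finset.sum_le_sum fun j _ ↦ mul_le_mul_of_nonneg_right
          (mod_cast choose_mul_doubleFactorial_le n j) (by positivity)
    _ = (x ^ 2 + ((2 * n - 1 : ℕ) * v : ℝ≥0) * y ^ 2) ^ n := by
        rw [add_comm (x ^ 2), add_pow]
        refine Finset.sum_congr rfl fun j _ ↦ ?_
        simp only [Nat.cast_mul, Nat.cast_pow, NNReal.coe_mul, NNReal.coe_natCast]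
        ring

theorem pow_add_neg_pow_le_pow_add_neg_pow {v w : ℝ} (h : |v| ≤ |w|) (i : ℕ) :
    v ^ i + (-v) ^ i ≤ w ^ i + (-w) ^ i := by
  rcases i.even_or_odd with hi | hi
  · rw [hi.neg_pow, hi.neg_pow, ← hi.pow_abs v, ← hi.pow_abs w]
    gcongr
  · simp only [hi.neg_pow, add_neg_cancel, le_refl]

theorem add_pow_add_sub_pow_le_add_pow_add_sub_pow {u v w : ℝ} (hu : 0 ≤ u) (h : |v| ≤ |w|)
    (m : ℕ) : (u + v) ^ m + (u - v) ^ m ≤ (u + w) ^ m + (u - w) ^ m := by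
  have hexpand (z : ℝ) : (u + z) ^ m + (u - z) ^ m =
      ∑ i ∈ Finset.range (m + 1), (z ^ i + (-z) ^ i) * (u ^ (m - i) * m.choose i) := by
    rw [sub_eq_add_neg, add_comm u, add_comm u, add_pow, add_pow, ← Finset.sum_add_distrib]
    exact Finset.sum_congr rfl fun i _ ↦ by ring
  rw [hexpand, hexpand]
  exact Finset.sum_le_sum fun i _ ↦ mul_le_mul_of_nonneg_right
    (pow_add_neg_pow_le_pow_add_neg_pow h i) (by positivity)

section InnerProductSpace

variable {H : Type*} [NormedAddCommGroup H] [InnerProductSpace ℝ H]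

theorem norm_add_pow_add_norm_sub_pow_le {a b : H} {r : ℝ} (hr : ‖b‖ = |r|) (m : ℕ) :
    ‖a + b‖ ^ (2 * m) + ‖a - b‖ ^ (2 * m) ≤ (‖a‖ + r) ^ (2 * m) + (‖a‖ - r) ^ (2 * m) := by
  have hcs : |2 * inner ℝ a b| ≤ |2 * (‖a‖ * r)| := by
    rw [abs_mul, abs_mul, abs_mul, abs_norm, ← hr]
    gcongr
    exact abs_real_inner_le_norm a b
  have hadd : ‖a + b‖ ^ 2 = ‖a‖ ^ 2 + r ^ 2 + 2 * inner ℝ a b := by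
    rw [norm_add_sq_real, hr, sq_abs]; ring
  have hsub : ‖a - b‖ ^ 2 = ‖a‖ ^ 2 + r ^ 2 - 2 * inner ℝ a b := by
    rw [norm_sub_sq_real, hr, sq_abs]; ring
  calc ‖a + b‖ ^ (2 * m) + ‖a - b‖ ^ (2 * m)
      = (‖a‖ ^ 2 + r ^ 2 + 2 * inner ℝ a b) ^ m + (‖a‖ ^ 2 + r ^ 2 - 2 * inner ℝ a b) ^ m := by
        rw [pow_mul, pow_mul, hadd, hsub]
    _ ≤ (‖a‖ ^ 2 + r ^ 2 + 2 * (‖a‖ * r)) ^ m + (‖a‖ ^ 2 + r ^ 2 - 2 * (‖a‖ * r)) ^ m :=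
        add_pow_add_sub_pow_le_add_pow_add_sub_pow (by positivity) hcs m
    _ = (‖a‖ + r) ^ (2 * m) + (‖a‖ - r) ^ (2 * m) := by
        rw [pow_mul, pow_mul, add_sq', sub_sq', ← mul_assoc]

theorem lintegral_norm_add_smul_pow_le {μ : Measure ℝ} [μ.IsNegInvariant] (a b : H) (n : ℕ) :
    ∫⁻ t, ENNReal.ofReal (‖a + t • b‖ ^ (2 * n)) ∂μ
      ≤ ∫⁻ t, ENNReal.ofReal ((‖a‖ + t * ‖b‖) ^ (2 * n)) ∂μ := by
  have hmeas : Measurable fun t : ℝ ↦ ENNReal.ofReal (‖a + t • b‖ ^ (2 * n)) :=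
    (ENNReal.continuous_ofReal.comp (by fun_prop)).measurable
  rw [← ENNReal.mul_le_mul_iff_right two_ne_zero ENNReal.ofNat_ne_top,
    two_mul_lintegral_eq_lintegral_add_comp_neg hmeas,
    two_mul_lintegral_eq_lintegral_add_comp_neg (by fun_prop)]
  refine lintegral_mono fun t ↦ ?_
  have hnonneg (z : ℝ) : 0 ≤ z ^ (2 * n) := (even_two_mul n).pow_nonneg z
  rw [← ENNReal.ofReal_add (hnonneg _) (hnonneg _), ← ENNReal.ofReal_add (hnonneg _) (hnonneg _)]
  refine ENNReal.ofReal_le_ofReal ?_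
  simpa only [neg_smul, neg_mul, ← sub_eq_add_neg] using
    norm_add_pow_add_norm_sub_pow_le (a := a) (b := t • b) (r := t * ‖b‖)
      (by rw [norm_smul, Real.norm_eq_abs, abs_mul, abs_norm]) n

theorem IsHypercontractive.lintegral_norm_add_smul_pow_le {μ : Measure ℝ} [μ.IsNegInvariant]
    {n : ℕ} {K : ℝ≥0} (h : IsHypercontractive μ n K) (a b : H) :
    ∫⁻ t, ENNReal.ofReal (‖a + t • b‖ ^ (2 * n)) ∂μ
      ≤ ENNReal.ofReal ((‖a‖ ^ 2 + K * ‖b‖ ^ 2) ^ n) :=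
  (_root_.lintegral_norm_add_smul_pow_le a b n).trans (h _ _)

end InnerProductSpace

/-- The multilinear polynomial with vector coefficients `c A` in the variables `x s`, `s ∈ T`, of
which a Wiener chaos is the value at independent Gaussians. The coefficient family is indexed by all
finite sets, but only the subsets of `T` contribute. -/
def multilinearPoly {R S M : Type*} [CommSemiring R] [AddCommMonoid M] [Module R M]
    (T : Finset S) (c : Finset S → M) (x : S → R) : M :=
  ∑ A ∈ T.powerset, (∏ s ∈ A, x s) • c A

section MultilinearPoly

variable {R S M : Type*} [CommSemiring R]

@[fun_prop]
theorem continuous_multilinearPoly [TopologicalSpace R] [ContinuousMul R] [AddCommMonoid M]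
    [Module R M] [TopologicalSpace M] [ContinuousAdd M] [ContinuousSMul R M] (T : Finset S)
    (c : Finset S → M) : Continuous (multilinearPoly (R := R) T c) := by
  unfold multilinearPoly
  fun_prop

theorem measurable_ofReal_norm_multilinearPoly_pow [Countable S] [NormedAddCommGroup M]
    [NormedSpace ℝ M] (T : Finset S) (c : Finset S → M) (m : ℕ) :
    Measurable fun x : S → ℝ ↦ ENNReal.ofReal (‖multilinearPoly T c x‖ ^ m) :=
  (ENNReal.continuous_ofReal.comp (by fun_prop)).measurable

theorem multilinearPoly_insert_update [DecidableEq S] [AddCommMonoid M] [Module R M]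
    {T : Finset S} {i : S} (hi : i ∉ T) (c : Finset S → M) (x : S → R) (t : R) :
    multilinearPoly (insert i T) c (Function.update x i t) =
      multilinearPoly T c x + t • multilinearPoly T (fun A ↦ c (insert i A)) x := by
  unfold multilinearPoly
  rw [Finset.sum_powerset_insert hi, Finset.smul_sum]
  congr 1 <;> refine Finset.sum_congr rfl fun A hA ↦ ?_
  all_goals have hiA : i ∉ A := fun h ↦ hi (Finset.mem_powerset.1 hA h)
  · rw [Finset.prod_update_of_notMem hiA]
  · rw [Finset.prod_insert hiA, Function.update_self, Finset.prod_update_of_notMem hiA, mul_smul]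

theorem multilinearPoly_toLp_smul [AddCommGroup M] [Module R M] (T : Finset S)
    (c c' : Finset S → M) (r : R) (x : S → R) :
    multilinearPoly T (fun A ↦ WithLp.toLp 2 (c A, r • c' A)) x =
      WithLp.toLp 2 (multilinearPoly T c x, r • multilinearPoly T c' x) := by
  simp only [multilinearPoly, ← WithLp.toLp_smul, ← WithLp.toLp_sum, Prod.smul_mk,
    Finset.smul_sum, prod_mk_sum, smul_comm r]

end MultilinearPoly

theorem norm_toLp_sqrt_smul_sq {E : Type*} [SeminormedAddCommGroup E] [NormedSpace ℝ E] (K : ℝ≥0)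
    (a b : E) : ‖WithLp.toLp 2 (a, √(K : ℝ) • b)‖ ^ 2 = ‖a‖ ^ 2 + K * ‖b‖ ^ 2 := by
  rw [WithLp.prod_norm_sq_eq_of_L2, WithLp.toLp_fst, WithLp.toLp_snd, norm_smul, mul_pow,
    Real.norm_eq_abs, sq_abs, Real.sq_sqrt K.coe_nonneg]

theorem lmarginal_norm_multilinearPoly_pow_le {S H : Type*} [Countable S] [DecidableEq S]
    [NormedAddCommGroup H] [InnerProductSpace ℝ H] {μ : S → Measure ℝ} [∀ s, SigmaFinite (μ s)]
    [∀ s, (μ s).IsNegInvariant] {n : ℕ} {K : ℝ≥0} (hμ : ∀ s, IsHypercontractive (μ s) n K)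
    (T : Finset S) (c : Finset S → H) (x : S → ℝ) :
    (∫⋯∫⁻_T, fun y ↦ ENNReal.ofReal (‖multilinearPoly T c y‖ ^ (2 * n)) ∂μ) x
      ≤ ENNReal.ofReal ((∑ A ∈ T.powerset, K ^ A.card * ‖c A‖ ^ 2) ^ n) := by
  induction T using Finset.induction_on generalizing H with
  | empty => simp [multilinearPoly, pow_mul]
  | insert i T hi ih =>
    let d (A : Finset S) : WithLp 2 (H × H) := WithLp.toLp 2 (c A, √(K : ℝ) • c (insert i A))
    have hstep (y : S → ℝ) : ∫⁻ t, ENNReal.ofReal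
        (‖multilinearPoly (insert i T) c (Function.update y i t)‖ ^ (2 * n)) ∂μ i
        ≤ ENNReal.ofReal (‖multilinearPoly T d y‖ ^ (2 * n)) := by
      simp only [multilinearPoly_insert_update hi]
      rw [pow_mul _ 2, multilinearPoly_toLp_smul, norm_toLp_sqrt_smul_sq]
      exact (hμ i).lintegral_norm_add_smul_pow_le _ _
    have hsum : ∑ A ∈ T.powerset, K ^ A.card * ‖d A‖ ^ 2 =
        ∑ A ∈ (insert i T).powerset, K ^ A.card * ‖c A‖ ^ 2 := by
      rw [Finset.sum_powerset_insert hi, ← Finset.sum_add_distrib]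
      refine Finset.sum_congr rfl fun A hA ↦ ?_
      have hiA : i ∉ A := fun h ↦ hi (Finset.mem_powerset.1 hA h)
      rw [norm_toLp_sqrt_smul_sq, Finset.card_insert_of_notMem hiA]
      ring
    rw [lmarginal_insert' _ (measurable_ofReal_norm_multilinearPoly_pow _ _ _) hi, ← hsum]
    exact (lmarginal_mono hstep x).trans (ih d)

section MomentBounds

variable {Ω E : Type*} [MeasurableSpace Ω] {μ : Measure Ω} [NormedAddCommGroup E] {f : Ω → E}
  {B : ℝ}

theorem eLpNorm_le_ofReal_of_lintegral_norm_pow_le {m : ℕ} (hB : 0 ≤ B)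
    (h : ∫⁻ ω, ENNReal.ofReal (‖f ω‖ ^ m) ∂μ ≤ ENNReal.ofReal (B ^ m)) :
    eLpNorm f m μ ≤ ENNReal.ofReal B := by
  rcases eq_or_ne m 0 with rfl | hm
  · simp
  have hpow : eLpNorm f m μ ^ (m : ℝ) = ∫⁻ ω, ENNReal.ofReal (‖f ω‖ ^ m) ∂μ := by
    have hm' : (m : ℝ≥0) ≠ 0 := mod_cast hm
    simpa only [ENNReal.ofReal_pow (norm_nonneg _), ofReal_norm, NNReal.coe_natCast,
      ENNReal.rpow_natCast, ENNReal.coe_natCast] using eLpNorm_nnreal_pow_eq_lintegral hm' (f := f)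
  rwa [← hpow, ENNReal.ofReal_pow hB, ENNReal.rpow_natCast, ENNReal.pow_le_pow_left_iff hm] at h

theorem integral_norm_rpow_le_of_eLpNorm_le (hf : AEStronglyMeasurable f μ) {p : ℝ} (hp : 0 < p)
    (hB : 0 ≤ B) (h : eLpNorm f (ENNReal.ofReal p) μ ≤ ENNReal.ofReal B) :
    Integrable (fun ω ↦ ‖f ω‖ ^ p) μ ∧ ∫ ω, ‖f ω‖ ^ p ∂μ ≤ B ^ p := by
  have hLp : MemLp f (ENNReal.ofReal p) μ := ⟨hf, h.trans_lt ENNReal.ofReal_lt_top⟩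
  have hp0 : ENNReal.ofReal p ≠ 0 := (ENNReal.ofReal_pos.2 hp).ne'
  have hint := hLp.integrable_norm_rpow hp0 ENNReal.ofReal_ne_top
  rw [hLp.eLpNorm_eq_integral_rpow_norm hp0 ENNReal.ofReal_ne_top,
    ENNReal.ofReal_le_ofReal_iff hB] at h
  rw [ENNReal.toReal_ofReal hp.le] at hint h
  exact ⟨hint, (Real.rpow_inv_le_iff_of_pos (by positivity) hB hp).1 h⟩

end MomentBounds

theorem sum_apply_extend_subtype_val {α M N : Type*} [Fintype α] [Zero M] [AddCommMonoid N]
    {q : α → Prop} [Fintype (Subtype q)] (c : Subtype q → M) {F : α → M → N}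
    (hF : ∀ a, F a 0 = 0) :
    ∑ a, F a (Function.extend Subtype.val c 0 a) = ∑ a : Subtype q, F a (c a) := by
  refine (Fintype.sum_of_injective Subtype.val Subtype.val_injective _ _ (fun a ha ↦ ?_)
    fun a ↦ ?_).symm
  · rw [Function.extend_apply' _ _ _ fun ⟨b, hb⟩ ↦ ha ⟨b, hb⟩, Pi.zero_apply, hF]
  · rw [Subtype.val_injective.extend_apply]

section IndependentVariables

variable {Ω S : Type*} [MeasurableSpace Ω] {P : Measure Ω} [Fintype S]
  {H : Type*} [NormedAddCommGroup H] [InnerProductSpace ℝ H]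
  {μ : S → Measure ℝ} {g : S → Ω → ℝ} {n : ℕ} {K : ℝ≥0}

theorem eLpNorm_multilinearPoly_comp_le [∀ s, (μ s).IsNegInvariant]
    (hμ : ∀ s, IsHypercontractive (μ s) n K) (hlaw : ∀ s, HasLaw (g s) (μ s) P)
    (hind : iIndepFun g P) (c : Finset S → H) :
    eLpNorm (fun ω ↦ multilinearPoly Finset.univ c (g · ω)) (2 * n : ℕ) P
      ≤ ENNReal.ofReal √(∑ A, K ^ A.card * ‖c A‖ ^ 2) := by
  classical
  have := hind.isProbabilityMeasure
  have (s : S) : IsProbabilityMeasure (μ s) := (hlaw s).isProbabilityMeasure_iff.1 ‹_›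
  refine eLpNorm_le_ofReal_of_lintegral_norm_pow_le (Real.sqrt_nonneg _) ?_
  have hmeas := measurable_ofReal_norm_multilinearPoly_pow Finset.univ c (2 * n)
  rw [(hind.hasLaw_pi hlaw).lintegral_comp hmeas.aemeasurable, lintegral_eq_lmarginal_univ 0,
    pow_mul √_, Real.sq_sqrt (by positivity), ← Finset.powerset_univ]
  exact lmarginal_norm_multilinearPoly_pow_le hμ _ c 0

theorem integral_norm_multilinearPoly_comp_rpow_le [∀ s, (μ s).IsNegInvariant]
    (hμ : ∀ s, IsHypercontractive (μ s) n K) (hK : 1 ≤ K)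
    (hlaw : ∀ s, HasLaw (g s) (μ s) P) (hind : iIndepFun g P) {k : ℕ} {c : Finset S → H}
    (hc : ∀ A, k < A.card → c A = 0) {p : ℝ} (hp : 0 < p) (hpn : p ≤ 2 * n) :
    Integrable (fun ω ↦ ‖multilinearPoly Finset.univ c (g · ω)‖ ^ p) P ∧
      ∫ ω, ‖multilinearPoly Finset.univ c (g · ω)‖ ^ p ∂P
        ≤ (K : ℝ) ^ (k * p / 2) * (∑ A, ‖c A‖ ^ 2) ^ (p / 2) := by
  have := hind.isProbabilityMeasure
  have hmeas : AEStronglyMeasurable (fun ω ↦ multilinearPoly Finset.univ c (g · ω)) P :=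
    (continuous_multilinearPoly _ c).comp_aestronglyMeasurable
      (hind.hasLaw_pi hlaw).aemeasurable.aestronglyMeasurable
  have hdegree : ∑ A, K ^ A.card * ‖c A‖ ^ 2 ≤ K ^ k * ∑ A, ‖c A‖ ^ 2 := by
    rw [Finset.mul_sum]
    refine Finset.sum_le_sum fun A _ ↦ ?_
    rcases lt_or_ge k A.card with hA | hA
    · simp [hc A hA]
    · gcongr
  have hnorm : eLpNorm (fun ω ↦ multilinearPoly Finset.univ c (g · ω)) (ENNReal.ofReal p) P
      ≤ ENNReal.ofReal √(K ^ k * ∑ A, ‖c A‖ ^ 2) := by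
    refine (eLpNorm_le_eLpNorm_of_exponent_le ?_ hmeas).trans
      ((eLpNorm_multilinearPoly_comp_le hμ hlaw hind c).trans (by gcongr))
    exact ENNReal.ofReal_le_of_le_toReal (by simpa using hpn)
  have hbound : √(K ^ k * ∑ A, ‖c A‖ ^ 2) ^ p =
      (K : ℝ) ^ (k * p / 2) * (∑ A, ‖c A‖ ^ 2) ^ (p / 2) := by
    rw [Real.sqrt_eq_rpow, ← Real.rpow_mul (by positivity), Real.mul_rpow (by positivity)
      (by positivity), ← Real.rpow_natCast_mul (by positivity)]
    ring_nf
  rw [← hbound]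
  exact integral_norm_rpow_le_of_eLpNorm_le hmeas hp (Real.sqrt_nonneg _) hnorm

theorem integral_norm_sum_prod_smul_rpow_le [∀ s, (μ s).IsNegInvariant]
    (hμ : ∀ s, IsHypercontractive (μ s) n K) (hK : 1 ≤ K)
    (hlaw : ∀ s, HasLaw (g s) (μ s) P) (hind : iIndepFun g P) {k : ℕ}
    (c : {A : Finset S // A.card ≤ k} → H) {p : ℝ} (hp : 0 < p) (hpn : p ≤ 2 * n) :
    Integrable (fun ω ↦ ‖∑ A, (∏ s ∈ A.1, g s ω) • c A‖ ^ p) P ∧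
      ∫ ω, ‖∑ A, (∏ s ∈ A.1, g s ω) • c A‖ ^ p ∂P
        ≤ (K : ℝ) ^ (k * p / 2) * (∑ A, ‖c A‖ ^ 2) ^ (p / 2) := by
  let c' : Finset S → H := Function.extend Subtype.val c 0
  have hc (A : Finset S) (hA : k < A.card) : c' A = 0 :=
    Function.extend_apply' _ _ _ fun ⟨B, hB⟩ ↦ (hB ▸ B.2).not_gt hA
  have hpoly (x : S → ℝ) : multilinearPoly Finset.univ c' x = ∑ A, (∏ s ∈ A.1, x s) • c A := by
    rw [multilinearPoly, Finset.powerset_univ]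
    exact sum_apply_extend_subtype_val c fun _ ↦ smul_zero _
  have hnorm : ∑ A, ‖c' A‖ ^ 2 = ∑ A, ‖c A‖ ^ 2 :=
    sum_apply_extend_subtype_val (F := fun _ v ↦ ‖v‖ ^ 2) c fun _ ↦ by simp
  simpa only [hpoly, hnorm] using
    integral_norm_multilinearPoly_comp_rpow_le hμ hK hlaw hind hc hp hpn

end IndependentVariables

theorem corollary2p6_general {Ω : Type*} [MeasurableSpace Ω] {P : Measure Ω}
    {S : Type*} [Fintype S] {H : Type*} [NormedAddCommGroup H] [InnerProductSpace ℝ H]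
    {g : S → Ω → ℝ} (hlaw : ∀ s, HasLaw (g s) (gaussianReal 0 1) P) (hind : iIndepFun g P)
    {k : ℕ} (c : {A : Finset S // A.card ≤ k} → H) {p : ℝ} (hp : 0 < p) :
    Integrable (fun ω ↦ ‖∑ A, (∏ s ∈ A.1, g s ω) • c A‖ ^ p) P ∧
      ∫ ω, ‖∑ A, (∏ s ∈ A.1, g s ω) • c A‖ ^ p ∂P
        ≤ (p + 1) ^ (k * p / 2) * (∑ A, ‖c A‖ ^ 2) ^ (p / 2) := by
  let n := ⌊p / 2⌋₊ + 1
  let K : ℝ≥0 := (2 * n - 1 : ℕ) * 1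
  have hpn : p ≤ 2 * n := by
    have := Nat.lt_floor_add_one (p / 2)
    push_cast [n]
    linarith
  have hKn : (K : ℝ) = 2 * ⌊p / 2⌋₊ + 1 := by simp [K, n, mul_add_one]
  have hK : 1 ≤ K := by
    rw [← NNReal.coe_le_coe, hKn]
    simp
  have hKp : (K : ℝ) ≤ p + 1 := by
    have := Nat.floor_le (by positivity : 0 ≤ p / 2)
    linarith
  refine (integral_norm_sum_prod_smul_rpow_le (fun _ ↦ isHypercontractive_gaussianReal 1 n)
    hK hlaw hind c hp hpn).imp_right fun h ↦ h.trans ?_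
  gcongr

theorem corollary2p6 :
    ∃ C : ℝ, 0 < C ∧
      ∀ {Ω : Type*} [MeasurableSpace Ω] (P : Measure Ω) [IsProbabilityMeasure P]
        {S : Type*} [Fintype S]
        {H : Type*} [NormedAddCommGroup H] [InnerProductSpace ℂ H] [FiniteDimensional ℂ H]
        (g : S → Ω → ℝ) (_ : ∀ s, HasLaw (g s) (gaussianReal 0 1) P) (_ : iIndepFun g P)
        (k : ℕ) (c : {A : Finset S // A.card ≤ k} → H)
        (p : ℝ) (_ : 2 ≤ p),
        Integrable (fun ω => ‖∑ A, ((∏ s ∈ A.1, g s ω : ℝ) : ℂ) • c A‖ ^ p) P ∧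
        ∫ ω, ‖∑ A, ((∏ s ∈ A.1, g s ω : ℝ) : ℂ) • c A‖ ^ p ∂P
          ≤ (C * p) ^ ((k : ℝ) * p / 2) * (∑ A, ‖c A‖ ^ 2) ^ (p / 2) := by
  refine ⟨2, two_pos, fun P _ S _ H _ _ _ g hlaw hind k c p hp ↦ ?_⟩
  let _ : InnerProductSpace ℝ H := .complexToReal
  simp only [Complex.coe_smul]
  exact (corollary2p6_general hlaw hind c (by linarith)).imp_right
    fun h ↦ h.trans (by gcongr; linarith)
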